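/- Consider the radar part of a frequency-division sensing and communications (FDSAC) scheme with $M$ receive antennas, pulse length $L\ge 1$ and total power budget $p$ per time slot. A fraction $\kappa\in[0,1)$ of the bandwidth and a fraction $\mu\in[0,1]$ of the power are used for communications, the rest for sensing. The radar waveform is $\mathbf x=\sqrt{(1-\mu)p}\,\mathbf s\in\mathbb C^{L}$, where $\mathbf s$ is a possibly random waveform that does not depend on $p$ and satisfies $\|\mathbf s\|^2=L$ almost surely (so $\mathbf x^{\mathsf H}\mathbf x=(1-\mu)pL$). The echo is $\mathbf Y_{\rm s}=\mathbf g\mathbf x^{\mathsf T}+\mathbf N_{\rm s}\in\mathbb C^{M\times L}$. Here $\mathbf N_{\rm s}$ has i.i.d. $\mathcal{CN}(0,(1-\kappa)\sigma_{\rm s}^2)$ entries, with $\sigma_{\rm s}>0$, and $\mathbf g=\sum_{k=1}^K\beta_k\mathbf a(\theta_k)$ is the target response, with arbitrary steering vectors $\mathbf a(\theta_k)\in\mathbb C^M$ and jointly circularly-symmetric complex Gaussian amplitudes $\beta_k\sim\mathcal{CN}(0,\sigma_k^2)$ (for instance independent ones). The waveform, the amplitudes and the noise are mutually independent. The sensing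 rate is the mutual information in bits per unit time, $\mathcal R_{\rm f}^{\rm s}(p)=\frac{1-\kappa}{L}I(\mathbf Y_{\rm s};\mathbf g\mid\mathbf x)$. Let $\mathbf R=\mathbb E\{\mathbf g\mathbf g^{\mathsf H}\}$, $\mathsf r=\operatorname{rank}\mathbf R$, and let $\lambda_1,\dots,\lambda_{\mathsf r}$ be the positive eigenvalues of $\mathbf R$, counted with multiplicity. Then, for every $p\ge 0$, $I(\mathbf Y_{\rm s};\mathbf g\mid\mathbf x)$ is finite and $$\mathcal R_{\rm f}^{\rm s}(p)=\frac{1-\kappa}{L}\log_2\det\Big(\mathbf I_M+\frac{(1-\mu)pL}{(1-\kappa)\sigma_{\rm s}^2}\mathbf R\Big).$$ If moreover $\mu<1$, then, as $p\to\infty$, $$\mathcal R_{\rm f}^{\rm s}(p)=\frac{\mathsf r(1-\kappa)}{L}\log_2 p+\frac{1-\kappa}{L}\sum_{a=1}^{\mathsf r}\log_2\frac{(1-\mu)\lambda_aL}{(1-\kappa)\sigma_{\rm s}^2}+o(1),$$ and hence the high-SNR slope is $\lim_{p\to\infty}\mathcal R_{\rm f}^{\rm s}(p)/\log_2 p=\frac{(1-\kappa)\mathsf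 r}{L}$. -/

import Mathlib

open MeasureTheory ProbabilityTheory Filter Topology
open scoped ENNReal NNReal

/-- The circularly-symmetric complex Gaussian law `CN(0, v)`: independent real and imaginary
parts, each `N(0, v / 2)`, so that `E|z|² = v`. -/
noncomputable def complexGaussian (v : ℝ≥0) : Measure ℂ :=
  ((gaussianReal 0 (v / 2)).prod (gaussianReal 0 (v / 2))).map
    (fun z : ℝ × ℝ => (z.1 : ℂ) + (z.2 : ℂ) * Complex.I)

/-- The random variables `b k` are jointly circularly-symmetric (zero-mean) complex Gaussian:
every complex linear combination of them has a law `CN(0, v)`. In particular each `b k` has a law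
`CN(0, σ_k²)`; independent variables with such laws satisfy this. -/
def IsCircularGaussian {Ω : Type*} [MeasurableSpace Ω] (P : Measure Ω) {K : ℕ}
    (b : Ω → Fin K → ℂ) : Prop :=
  ∀ c : Fin K → ℂ, ∃ v : ℝ≥0, P.map (fun ω => ∑ k, c k * b ω k) = complexGaussian v

/-- Conditional mutual information `I(X; Y | Z)`, in nats: the Kullback-Leibler divergence of the
joint law of `(Z, (X, Y))` from the law `P_Z ⊗ (P_{X|Z} × P_{Y|Z})`. -/
noncomputable def condMutualInfo {Ω α β γ : Type*} [MeasurableSpace Ω]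
    [MeasurableSpace α] [StandardBorelSpace α] [Nonempty α]
    [MeasurableSpace β] [StandardBorelSpace β] [Nonempty β] [MeasurableSpace γ]
    (P : Measure Ω) [IsFiniteMeasure P] (X : Ω → α) (Y : Ω → β) (Z : Ω → γ) : ℝ≥0∞ :=
  InformationTheory.klDiv (P.map (fun ω => (Z ω, (X ω, Y ω))))
    ((P.map Z) ⊗ₘ ((condDistrib X Z P) ×ₖ (condDistrib Y Z P)))

/-- The target response vector `g = ∑ₖ βₖ a(θₖ)`, for the array steering vector `a`, the angles of
arrival `θₖ` and the complex amplitudes `βₖ`. -/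
noncomputable def targetResponse {Ω : Type*} {M K : ℕ} (a : ℝ → Fin M → ℂ) (θ : Fin K → ℝ)
    (b : Ω → Fin K → ℂ) (ω : Ω) : Fin M → ℂ :=
  ∑ k, b ω k • a (θ k)

/-- The correlation matrix `E[g gᴴ]` of a random vector `g`. -/
noncomputable def corrMatrix {Ω : Type*} [MeasurableSpace Ω] (P : Measure Ω) {M : ℕ}
    (g : Ω → Fin M → ℂ) : Matrix (Fin M) (Fin M) ℂ :=
  Matrix.of fun i j => ∫ ω, g ω i * (starRingEnd ℂ) (g ω j) ∂P

theorem corrMatrix_isHermitian {Ω : Type*} [MeasurableSpace Ω] (P : Measure Ω) {M : ℕ}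
    (g : Ω → Fin M → ℂ) : (corrMatrix P g).IsHermitian := by
  ext i j
  simp only [Matrix.conjTranspose_apply, corrMatrix, Matrix.of_apply, RCLike.star_def]
  rw [← integral_conj]
  congr 1
  funext ω
  simp [mul_comm]

/-- The radar waveform `x = √((1 - μ) p) s` of the frequency-division scheme: the share `(1 - μ) p`
of the power budget `p` is put on the unit-power waveform `s`. -/
noncomputable def radarWaveform {Ω : Type*} {L : ℕ} (μ p : ℝ) (s : Ω → Fin L → ℂ) (ω : Ω) :
    Fin L → ℂ :=
  fun l => (Real.sqrt ((1 - μ) * p) : ℂ) * s ω l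

/-- The reflected echo signal matrix `Y = g xᵀ + N`. -/
noncomputable def echoSignal {Ω : Type*} {M L : ℕ} (g : Ω → Fin M → ℂ) (x : Ω → Fin L → ℂ)
    (N : Ω → Fin M → Fin L → ℂ) (ω : Ω) : Fin M → Fin L → ℂ :=
  fun m l => g ω m * x ω l + N ω m l

/-- The sensing mutual information `I(Y; g | x)` (in nats) of the frequency-division scheme. -/
noncomputable def sensingMI {Ω : Type*} [MeasurableSpace Ω] (P : Measure Ω) [IsFiniteMeasure P]
    {M L : ℕ} (μ : ℝ) (g : Ω → Fin M → ℂ) (s : Ω → Fin L → ℂ) (N : Ω → Fin M → Fin L → ℂ)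
    (p : ℝ) : ℝ≥0∞ :=
  condMutualInfo P (echoSignal g (radarWaveform μ p s) N) g (radarWaveform μ p s)

/-- The sensing rate of the frequency-division scheme: the sensing mutual information in bits, per
unit time. On the radar sub-band, a fraction `1 - κ` of the total bandwidth, a symbol lasts
`1 / (1 - κ)` units of time, so the pulse of `L` symbols lasts `L / (1 - κ)`. -/
noncomputable def fdsacSensingRate {Ω : Type*} [MeasurableSpace Ω] (P : Measure Ω)
    [IsFiniteMeasure P] {M L : ℕ} (κ μ : ℝ) (g : Ω → Fin M → ℂ) (s : Ω → Fin L → ℂ)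
    (N : Ω → Fin M → Fin L → ℂ) (p : ℝ) : ℝ :=
  (1 - κ) / L * ((sensingMI P μ g s N p).toReal / Real.log 2)

/-! All densities are taken relative to the law of the noise. Given the waveform `x` and the
response `g`, the echo is the noise translated by `g xᵀ`, so by the Cameron-Martin formula
(`lintegral_noise_add`) the joint law of `(x, Y, g)` has an explicit density `exp r` with respect to
`P_x ⊗ P_N ⊗ P_g`. Integrating `g` out gives the density `exp k` of `Y` given `x`. Hence the
information density is `r - k` and the mutual information is its mean
(`condMutualInfo_eq_integral`). Since `P_g` itself is the reference for `g`, a singular `R` needs no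
special treatment.

A unitary `B` diagonalising `R` makes the coordinates of `B g` uncorrelated, hence independent
because they are jointly circular Gaussian. The density sees `Y` only through the matched filter
output `Y x̄`, so `k` is a sum of scalar Gaussian integrals, and `r - k` is a sum of information
densities of `M` scalar channels. The waveform energy `E` is almost surely constant, so the mean of
each term involves second moments only. The quadratic contributions cancel, leaving `log (1 + E λ_i
/ v)` (`integral_scalar_information_density`).

Summing gives `log det` by the spectral theorem. At high SNR each positive eigenvalue contributes
`log₂ p` plus a constant, and each zero eigenvalue contributes nothing. -/

/-! ### Real and complex scalar Gaussian integrals -/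

theorem lintegral_gaussianReal_zero_add {v : ℝ≥0} (hv : v ≠ 0) (a : ℝ) {f : ℝ → ℝ≥0∞}
    (hf : Measurable f) :
    ∫⁻ t, f (t + a) ∂(gaussianReal 0 v) =
      ∫⁻ t, f t * ENNReal.ofReal (Real.exp ((2 * a * t - a ^ 2) / (2 * v))) ∂(gaussianReal 0 v) := by
  have h := lintegral_map (μ := gaussianReal 0 v) hf (measurable_id.add_const a)
  simp only [id] at h
  rw [← h, gaussianReal_map_add_const, gaussianReal_of_var_ne_zero _ hv,
    gaussianReal_of_var_ne_zero _ hv,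
    lintegral_withDensity_eq_lintegral_mul _ (measurable_gaussianPDF _ _) hf,
    lintegral_withDensity_eq_lintegral_mul _ (measurable_gaussianPDF _ _) (by fun_prop)]
  congr 1
  funext t
  simp only [Pi.mul_apply, gaussianPDF, gaussianPDFReal]
  rw [mul_comm (f t), ← mul_assoc, ← ENNReal.ofReal_mul (by positivity), mul_assoc _ (Real.exp _),
    ← Real.exp_add]
  congr 4
  have : (v : ℝ) ≠ 0 := by exact_mod_cast hv
  field_simp
  ring

/-- Completing the square turns the integrand into a constant times another Gaussian density. The
case `v = 0` is kept because zero eigenvalues of `R` give degenerate coordinates. -/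
theorem lintegral_gaussianReal_zero_exp_sq (v : ℝ≥0) {c : ℝ} (hc : 0 ≤ c) (a : ℝ) :
    ∫⁻ t, ENNReal.ofReal (Real.exp (-c * t ^ 2 + 2 * a * t)) ∂(gaussianReal 0 v) =
      ENNReal.ofReal ((√(1 + 2 * c * v))⁻¹ * Real.exp (2 * a ^ 2 * v / (1 + 2 * c * v))) := by
  by_cases hv : v = 0
  · subst hv
    simp
  have hv' : (0 : ℝ) < v := lt_of_le_of_ne v.2 (fun h => hv (NNReal.coe_injective h.symm))
  have hd : 0 < 1 + 2 * c * v := by positivity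
  -- The tilted Gaussian has precision `1 / v + 2 c`, hence variance `w`, and mean `2 a w`.
  set w : ℝ≥0 := ⟨v / (1 + 2 * c * v), by positivity⟩
  have hw' : (w : ℝ) = v / (1 + 2 * c * v) := rfl
  have hw0 : w ≠ 0 := by
    intro h
    have : (w : ℝ) = 0 := by rw [h]; rfl
    rw [hw'] at this
    have : 0 < v / (1 + 2 * c * v) := by positivity
    linarith
  rw [gaussianReal_of_var_ne_zero _ hv,
    lintegral_withDensity_eq_lintegral_mul _ (measurable_gaussianPDF _ _) (by fun_prop)]
  have key : ∀ t : ℝ, (gaussianPDF 0 v * fun t => ENNReal.ofReal (Real.exp (-c * t ^ 2 + 2 * a * t))) t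
      = ENNReal.ofReal ((√(1 + 2 * c * v))⁻¹ * Real.exp (2 * a ^ 2 * v / (1 + 2 * c * v))) *
        gaussianPDF (2 * a * w) w t := by
    intro t
    simp only [Pi.mul_apply, gaussianPDF, gaussianPDFReal]
    rw [← ENNReal.ofReal_mul (by positivity), ← ENNReal.ofReal_mul (by positivity)]
    congr 1
    have e1 : √(2 * Real.pi * v) = √(1 + 2 * c * v) * √(2 * Real.pi * w) := by
      rw [← Real.sqrt_mul hd.le, hw']
      congr 1
      field_simp
    rw [e1, mul_inv, mul_assoc, ← Real.exp_add]
    rw [mul_assoc, mul_assoc _ (Real.exp _) (_ * _), mul_left_comm (Real.exp _), ← Real.exp_add]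
    congr 3
    rw [hw']
    field_simp
    ring_nf
  simp_rw [key]
  rw [lintegral_const_mul _ (measurable_gaussianPDF _ _), lintegral_gaussianPDF_eq_one _ hw0, mul_one]

instance (v : ℝ≥0) : IsProbabilityMeasure (complexGaussian v) :=
  Measure.isProbabilityMeasure_map (by fun_prop)

theorem lintegral_complexGaussian (v : ℝ≥0) {f : ℂ → ℝ≥0∞} (hf : Measurable f) :
    ∫⁻ z, f z ∂(complexGaussian v) =
      ∫⁻ x, ∫⁻ y, f (x + y * Complex.I) ∂(gaussianReal 0 (v / 2)) ∂(gaussianReal 0 (v / 2)) := by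
  rw [complexGaussian, lintegral_map hf (by fun_prop), lintegral_prod _ (by fun_prop)]

theorem lintegral_complexGaussian_add {v : ℝ≥0} (hv : v ≠ 0) (d : ℂ) {f : ℂ → ℝ≥0∞}
    (hf : Measurable f) :
    ∫⁻ z, f (z + d) ∂(complexGaussian v) =
      ∫⁻ z, f z * ENNReal.ofReal (Real.exp ((2 * (star d * z).re - ‖d‖ ^ 2) / v))
        ∂(complexGaussian v) := by
  have hv2 : v / 2 ≠ 0 := by simpa using hv
  have hv' : (v : ℝ) ≠ 0 := by exact_mod_cast hv
  rw [lintegral_complexGaussian _ (by fun_prop), lintegral_complexGaussian _ (by fun_prop)]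
  have h1 : ∀ x : ℝ, ∫⁻ y : ℝ, f (x + y * Complex.I + d) ∂(gaussianReal 0 (v / 2)) =
      ∫⁻ y : ℝ, f (((x + d.re : ℝ) : ℂ) + y * Complex.I) *
        ENNReal.ofReal (Real.exp ((2 * d.im * y - d.im ^ 2) / (2 * (v / 2 : ℝ≥0))))
        ∂(gaussianReal 0 (v / 2)) := by
    intro x
    rw [← lintegral_gaussianReal_zero_add hv2 d.im
      (f := fun y : ℝ => f (((x + d.re : ℝ) : ℂ) + y * Complex.I)) (by fun_prop)]
    congr 1
    funext y
    congr 1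
    apply Complex.ext <;> simp
  simp_rw [h1]
  rw [lintegral_gaussianReal_zero_add hv2 d.re (f := fun x : ℝ =>
    ∫⁻ y : ℝ, f ((x : ℂ) + y * Complex.I) *
        ENNReal.ofReal (Real.exp ((2 * d.im * y - d.im ^ 2) / (2 * (v / 2 : ℝ≥0))))
        ∂(gaussianReal 0 (v / 2)))]
  · congr 1
    funext x
    rw [← lintegral_mul_const _ (by fun_prop)]
    congr 1
    funext y
    rw [mul_assoc, ← ENNReal.ofReal_mul (by positivity), ← Real.exp_add]
    congr 3
    rw [Complex.sq_norm, Complex.normSq_apply]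
    simp
    field_simp
    ring
  · apply Measurable.lintegral_prod_right'
      (f := fun p : ℝ × ℝ => f ((p.1 : ℂ) + p.2 * Complex.I) *
        ENNReal.ofReal (Real.exp ((2 * d.im * p.2 - d.im ^ 2) / (2 * (v / 2 : ℝ≥0)))))
    fun_prop

theorem lintegral_complexGaussian_exp_sq (v : ℝ≥0) {c : ℝ} (hc : 0 ≤ c) (u : ℂ) :
    ∫⁻ z, ENNReal.ofReal (Real.exp (-c * ‖z‖ ^ 2 + 2 * (star z * u).re)) ∂(complexGaussian v) =
      ENNReal.ofReal ((1 + c * v)⁻¹ * Real.exp (v * ‖u‖ ^ 2 / (1 + c * v))) := by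
  rw [lintegral_complexGaussian _ (by fun_prop)]
  have h : ∀ x y : ℝ, ENNReal.ofReal (Real.exp (-c * ‖(x + y * Complex.I : ℂ)‖ ^ 2 +
        2 * (star (x + y * Complex.I : ℂ) * u).re)) =
      ENNReal.ofReal (Real.exp (-c * x ^ 2 + 2 * u.re * x)) *
        ENNReal.ofReal (Real.exp (-c * y ^ 2 + 2 * u.im * y)) := by
    intro x y
    rw [← ENNReal.ofReal_mul (by positivity), ← Real.exp_add]
    congr 2
    rw [Complex.sq_norm, Complex.normSq_apply]
    simp
    ring
  have hd : 0 ≤ 1 + c * v := by positivity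
  simp_rw [h]
  simp_rw [lintegral_const_mul' _ _ ENNReal.ofReal_ne_top, lintegral_gaussianReal_zero_exp_sq _ hc]
  rw [lintegral_mul_const' _ _ ENNReal.ofReal_ne_top, lintegral_gaussianReal_zero_exp_sq _ hc,
    ← ENNReal.ofReal_mul (by positivity)]
  congr 1
  have e : 1 + 2 * c * ((v / 2 : ℝ≥0) : ℝ) = 1 + c * v := by push_cast; ring
  rw [e, mul_mul_mul_comm, ← mul_inv, Real.mul_self_sqrt hd, ← Real.exp_add]
  congr 2
  rw [Complex.sq_norm, Complex.normSq_apply]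
  push_cast
  ring

/-- Used to deduce independence of the coordinates from their being uncorrelated. -/
theorem charFun_complexGaussian (v : ℝ≥0) (t : ℂ) :
    charFun (complexGaussian v) t = Complex.exp (-(v * ‖t‖ ^ 2 / 4)) := by
  rw [charFun_apply, complexGaussian, integral_map (by fun_prop) (by fun_prop)]
  have h : ∀ z : ℝ × ℝ, Complex.exp ((inner ℝ ((z.1 : ℂ) + z.2 * Complex.I) t : ℝ) * Complex.I) =
      Complex.exp (t.re * z.1 * Complex.I) * Complex.exp (t.im * z.2 * Complex.I) := by
    intro z
    rw [← Complex.exp_add]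
    congr 1
    rw [Complex.inner]
    simp
    ring
  simp_rw [h]
  rw [integral_prod_mul (fun x : ℝ => Complex.exp (t.re * x * Complex.I))
    (fun x : ℝ => Complex.exp (t.im * x * Complex.I)), ← charFun_apply_real, ← charFun_apply_real,
    charFun_gaussianReal, charFun_gaussianReal, ← Complex.exp_add]
  congr 1
  have : ((‖t‖ : ℂ)) ^ 2 = t.re ^ 2 + t.im ^ 2 := by
    rw [← Complex.ofReal_pow, Complex.sq_norm, Complex.normSq_apply]
    push_cast
    ring
  rw [this]
  push_cast
  ring

theorem memLp_id_complexGaussian (v : ℝ≥0) : MemLp id 2 (complexGaussian v) := by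
  rw [complexGaussian, memLp_map_measure_iff (by fun_prop) (by fun_prop)]
  have h := memLp_id_gaussianReal' (μ := 0) (v := v / 2) 2 (by simp)
  have h1 : MemLp (fun z : ℝ × ℝ => (z.1 : ℂ)) 2
      ((gaussianReal 0 (v / 2)).prod (gaussianReal 0 (v / 2))) :=
    (h.comp_measurePreserving measurePreserving_fst).ofReal
  have h2 : MemLp (fun z : ℝ × ℝ => (z.2 : ℂ)) 2
      ((gaussianReal 0 (v / 2)).prod (gaussianReal 0 (v / 2))) :=
    (h.comp_measurePreserving measurePreserving_snd).ofReal
  exact h1.add (h2.mul_const Complex.I)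

theorem integral_id_complexGaussian (v : ℝ≥0) : ∫ z, z ∂(complexGaussian v) = 0 := by
  have hi := (memLp_id_gaussianReal (μ := 0) (v := v / 2) 1).integrable (by norm_num)
  rw [complexGaussian, integral_map (by fun_prop) (by fun_prop), integral_add,
    integral_mul_const, integral_fun_fst (fun x : ℝ => (x : ℂ)),
    integral_fun_snd (fun x : ℝ => (x : ℂ)), integral_complex_ofReal]
  · simp
  · exact (hi.comp_fst _).ofReal
  · exact (hi.comp_snd _).ofReal.mul_const _

theorem integral_norm_sq_complexGaussian (v : ℝ≥0) :
    ∫ z, ‖z‖ ^ 2 ∂(complexGaussian v) = v := by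
  have hi := (memLp_id_gaussianReal (μ := 0) (v := v / 2) 2).integrable_sq
  have hm : ∫ x, x ^ 2 ∂(gaussianReal 0 (v / 2)) = (v : ℝ) / 2 := by
    have := variance_of_integral_eq_zero (μ := gaussianReal 0 (v / 2)) (X := fun x : ℝ => x)
      (by fun_prop) (by simp)
    rw [← this, variance_fun_id_gaussianReal]
    push_cast; rfl
  rw [complexGaussian, integral_map (by fun_prop) (by fun_prop)]
  have h : ∀ z : ℝ × ℝ, ‖(z.1 : ℂ) + z.2 * Complex.I‖ ^ 2 = z.1 ^ 2 + z.2 ^ 2 := by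
    intro z
    rw [Complex.sq_norm, Complex.normSq_apply]
    simp
    ring
  simp_rw [h]
  rw [integral_add, integral_fun_fst (fun x : ℝ => x ^ 2), integral_fun_snd (fun x : ℝ => x ^ 2), hm]
  · simp
  · exact hi.comp_fst _
  · exact hi.comp_snd _

/-! ### Conditional mutual information as the mean of a log-density -/

theorem klDiv_withDensity_exp {α : Type*} [MeasurableSpace α] {J D : Measure α}
    [IsProbabilityMeasure J] [IsProbabilityMeasure D] {h : α → ℝ} (hm : Measurable h)
    (hJ : J = D.withDensity (fun w => ENNReal.ofReal (Real.exp (h w)))) (hi : Integrable h J) :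
    InformationTheory.klDiv J D ≠ ∞ ∧ (InformationTheory.klDiv J D).toReal = ∫ w, h w ∂J := by
  have hac : J ≪ D := by rw [hJ]; exact withDensity_absolutelyContinuous _ _
  have hllr : llr J D =ᵐ[J] h := by
    have h1 : J.rnDeriv D =ᵐ[D] fun w => ENNReal.ofReal (Real.exp (h w)) := by
      rw [hJ]
      exact Measure.rnDeriv_withDensity D (by fun_prop)
    filter_upwards [hac.ae_le h1] with w hw
    rw [llr, hw, ENNReal.toReal_ofReal (Real.exp_pos _).le, Real.log_exp]
  refine ⟨InformationTheory.klDiv_ne_top hac (hi.congr hllr.symm), ?_⟩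
  -- Both measures have mass one, so the mass correction in the divergence vanishes.
  rw [InformationTheory.toReal_klDiv_of_measure_eq hac (by simp)]
  exact integral_congr_ae hllr

/-- Both measures have densities with respect to `P_Z ⊗ ν ⊗ P_Y`: `exp r` for the joint law and,
after integrating `y` out, `exp k` for the conditionally independent one. The ratio is `exp (r -
k)`. Independence of `Z` and `Y` makes the conditional law of `Y` constant. -/
theorem map_eq_withDensity_compProd_condDistrib {Ω α β γ : Type*} [MeasurableSpace Ω]
    [MeasurableSpace α] [StandardBorelSpace α] [Nonempty α]
    [MeasurableSpace β] [StandardBorelSpace β] [Nonempty β] [MeasurableSpace γ]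
    (P : Measure Ω) [IsProbabilityMeasure P] {X : Ω → α} {Y : Ω → β} {Z : Ω → γ}
    (hX : Measurable X) (hY : Measurable Y) (hZ : Measurable Z) (hZY : IndepFun Z Y P)
    (ν : Measure α) [IsProbabilityMeasure ν] {r : γ × (α × β) → ℝ} {k : γ × α → ℝ}
    (hr : Measurable r) (hk : Measurable k)
    (hJ : P.map (fun ω => (Z ω, (X ω, Y ω))) =
      ((P.map Z).prod (ν.prod (P.map Y))).withDensity (fun w => ENNReal.ofReal (Real.exp (r w))))
    (hrk : ∀ z x, ∫⁻ y, ENNReal.ofReal (Real.exp (r (z, (x, y)))) ∂(P.map Y) =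
      ENNReal.ofReal (Real.exp (k (z, x)))) :
    P.map (fun ω => (Z ω, (X ω, Y ω))) =
      ((P.map Z) ⊗ₘ ((condDistrib X Z P) ×ₖ (condDistrib Y Z P))).withDensity
        (fun w => ENNReal.ofReal (Real.exp (r w - k (w.1, w.2.1)))) := by
  have := Measure.isProbabilityMeasure_map (μ := P) hX.aemeasurable
  have := Measure.isProbabilityMeasure_map (μ := P) hY.aemeasurable
  have := Measure.isProbabilityMeasure_map (μ := P) hZ.aemeasurable
  have hcY : condDistrib Y Z P =ᵐ[P.map Z] Kernel.const γ (P.map Y) := by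
    refine condDistrib_ae_eq_of_measure_eq_compProd Z hY.aemeasurable ?_
    rw [Measure.compProd_const,
      (indepFun_iff_map_prod_eq_prod_map_map hZ.aemeasurable hY.aemeasurable).1 hZY]
  have hD : (P.map Z) ⊗ₘ ((condDistrib X Z P) ×ₖ (condDistrib Y Z P)) =
      ((P.map Z).prod (ν.prod (P.map Y))).withDensity
        (fun w => ENNReal.ofReal (Real.exp (k (w.1, w.2.1)))) := by
    refine Measure.ext_of_lintegral _ fun f hf => ?_
    rw [Measure.lintegral_compProd hf]
    have h1 : ∫⁻ z, ∫⁻ w, f (z, w) ∂((condDistrib X Z P) ×ₖ (condDistrib Y Z P)) z ∂(P.map Z) =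
        ∫⁻ z, ∫⁻ x, ∫⁻ y, f (z, (x, y)) ∂(P.map Y) ∂(condDistrib X Z P z) ∂(P.map Z) := by
      refine lintegral_congr_ae ?_
      filter_upwards [hcY] with z hz
      rw [Kernel.lintegral_prod _ _ _ (by fun_prop), hz]
      rfl
    have hF : Measurable (fun p : γ × α => ∫⁻ y, f (p.1, (p.2, y)) ∂(P.map Y)) :=
      Measurable.lintegral_prod_right' (f := fun q : (γ × α) × β => f (q.1.1, (q.1.2, q.2)))
        (by fun_prop)
    have hmXY : Measurable (fun w : γ × (α × β) => (w.1, w.2.1)) := by fun_prop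
    have h2 : P.map (fun ω => (Z ω, X ω)) =
        (P.map (fun ω => (Z ω, (X ω, Y ω)))).map (fun w => (w.1, w.2.1)) := by
      rw [Measure.map_map hmXY (by fun_prop)]
      rfl
    -- The conditional law of `X` is never computed: together with `P_Z` it recombines into the law
    -- of `(Z, X)`, a marginal of the joint law.
    rw [h1, ← Measure.lintegral_compProd (f := fun p : γ × α => ∫⁻ y, f (p.1, (p.2, y)) ∂(P.map Y)) hF,
      compProd_map_condDistrib hX.aemeasurable, h2, lintegral_map hF hmXY, hJ,
      lintegral_withDensity_eq_lintegral_mul _ (by fun_prop) (by fun_prop),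
      lintegral_withDensity_eq_lintegral_mul _ (by fun_prop) (by fun_prop),
      lintegral_prod _ (by fun_prop), lintegral_prod _ (by fun_prop)]
    refine lintegral_congr fun z => ?_
    simp only [Pi.mul_apply]
    have hF' : Measurable (fun x : α => ∫⁻ y, f (z, (x, y)) ∂(P.map Y)) :=
      hF.comp (g := fun p : γ × α => ∫⁻ y, f (p.1, (p.2, y)) ∂(P.map Y))
        (f := fun x : α => (z, x)) (by fun_prop)
    rw [lintegral_prod _ (by fun_prop), lintegral_prod _ (by fun_prop)]
    refine lintegral_congr fun x => ?_
    dsimp only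
    rw [lintegral_mul_const _ (by fun_prop), hrk, lintegral_const_mul _ (by fun_prop)]
  rw [hD, ← withDensity_mul _ (by fun_prop) (by fun_prop), hJ]
  congr 1
  funext w
  simp only [Pi.mul_apply]
  rw [← ENNReal.ofReal_mul (Real.exp_pos _).le, ← Real.exp_add]
  congr 2
  ring

theorem condMutualInfo_eq_integral {Ω α β γ : Type*} [MeasurableSpace Ω]
    [MeasurableSpace α] [StandardBorelSpace α] [Nonempty α]
    [MeasurableSpace β] [StandardBorelSpace β] [Nonempty β] [MeasurableSpace γ]
    (P : Measure Ω) [IsProbabilityMeasure P] {X : Ω → α} {Y : Ω → β} {Z : Ω → γ}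
    (hX : Measurable X) (hY : Measurable Y) (hZ : Measurable Z) (hZY : IndepFun Z Y P)
    (ν : Measure α) [IsProbabilityMeasure ν] {r : γ × (α × β) → ℝ} {k : γ × α → ℝ}
    (hr : Measurable r) (hk : Measurable k)
    (hJ : P.map (fun ω => (Z ω, (X ω, Y ω))) =
      ((P.map Z).prod (ν.prod (P.map Y))).withDensity (fun w => ENNReal.ofReal (Real.exp (r w))))
    (hrk : ∀ z x, ∫⁻ y, ENNReal.ofReal (Real.exp (r (z, (x, y)))) ∂(P.map Y) =
      ENNReal.ofReal (Real.exp (k (z, x))))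
    (hi : Integrable (fun ω => r (Z ω, (X ω, Y ω)) - k (Z ω, X ω)) P) :
    condMutualInfo P X Y Z ≠ ∞ ∧
      (condMutualInfo P X Y Z).toReal = ∫ ω, (r (Z ω, (X ω, Y ω)) - k (Z ω, X ω)) ∂P := by
  have hm : Measurable fun ω => (Z ω, (X ω, Y ω)) := by fun_prop
  have := Measure.isProbabilityMeasure_map (μ := P) hm.aemeasurable
  have := Measure.isProbabilityMeasure_map (μ := P) hZ.aemeasurable
  have hh : Measurable fun w : γ × (α × β) => r w - k (w.1, w.2.1) := by fun_prop
  obtain ⟨h1, h2⟩ := klDiv_withDensity_exp hh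
    (map_eq_withDensity_compProd_condDistrib P hX hY hZ hZY ν hr hk hJ hrk)
    ((integrable_map_measure hh.aestronglyMeasurable hm.aemeasurable).2 hi)
  refine ⟨h1, h2.trans ?_⟩
  rw [integral_map hm.aemeasurable hh.aestronglyMeasurable]

/-! ### Correlation matrices under linear maps -/

theorem MeasureTheory.MemLp.integrable_mul_conj {Ω : Type*} [MeasurableSpace Ω] {P : Measure Ω}
    {f g : Ω → ℂ} (hf : MemLp f 2 P) (hg : MemLp g 2 P) :
    Integrable (fun ω => f ω * (starRingEnd ℂ) (g ω)) P :=
  hf.integrable_mul hg.star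

theorem corrMatrix_mulVec {Ω : Type*} [MeasurableSpace Ω] {P : Measure Ω} {n m : ℕ}
    {X : Ω → Fin n → ℂ} (hX : ∀ i, MemLp (fun ω => X ω i) 2 P) (B : Matrix (Fin m) (Fin n) ℂ) :
    corrMatrix P (fun ω => B.mulVec (X ω)) = B * corrMatrix P X * B.conjTranspose := by
  ext i j
  simp only [corrMatrix, Matrix.of_apply, Matrix.mul_apply, Matrix.mulVec, dotProduct,
    Matrix.conjTranspose_apply, map_sum, map_mul]
  have h : ∀ a b, Integrable (fun ω => (B i b * X ω b) * ((starRingEnd ℂ) (B j a) *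
      (starRingEnd ℂ) (X ω a))) P := by
    intro a b
    refine (((hX b).integrable_mul_conj (hX a)).const_mul (B i b * (starRingEnd ℂ) (B j a))).congr ?_
    exact ae_of_all _ fun ω => by simp only; ring
  simp_rw [Finset.mul_sum, Finset.sum_mul]
  rw [integral_finsetSum _ fun a _ => integrable_finsetSum _ fun b _ => h a b]
  refine Finset.sum_congr rfl fun a _ => ?_
  rw [integral_finsetSum _ fun b _ => h a b]
  refine Finset.sum_congr rfl fun b _ => ?_
  rw [mul_right_comm, RCLike.star_def, ← integral_const_mul]
  congr 1
  funext ω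
  ring

theorem integral_norm_sq_sum_of_corrMatrix_diagonal {Ω : Type*} [MeasurableSpace Ω]
    {P : Measure Ω} {n : ℕ} {X : Ω → Fin n → ℂ} (hX : ∀ i, MemLp (fun ω => X ω i) 2 P)
    {d : Fin n → ℝ} (hd : corrMatrix P X = Matrix.diagonal fun i => (d i : ℂ)) (c : Fin n → ℂ) :
    ∫ ω, ‖∑ i, c i * X ω i‖ ^ 2 ∂P = ∑ i, ‖c i‖ ^ 2 * d i := by
  -- The linear form `c` is read as a matrix with one row.
  have h := congrFun (congrFun (corrMatrix_mulVec hX (Matrix.of fun (_ : Fin 1) i => c i)) 0) 0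
  rw [hd] at h
  simp only [corrMatrix, Matrix.of_apply, Matrix.mulVec, dotProduct, Complex.mul_conj',
    Matrix.mul_diagonal, Matrix.mul_apply (M := _ * _), Matrix.conjTranspose_apply] at h
  simp_rw [← Complex.ofReal_pow] at h
  rw [integral_complex_ofReal] at h
  apply Complex.ofReal_injective
  rw [h]
  push_cast
  refine Finset.sum_congr rfl fun i _ => ?_
  rw [mul_right_comm, RCLike.star_def, Complex.mul_conj']

/-! ### Circular Gaussian vectors -/

section Circular

variable {Ω : Type*} [MeasurableSpace Ω] {P : Measure Ω} {n : ℕ} {X : Ω → Fin n → ℂ}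

theorem memLp_of_map_eq_complexGaussian {f : Ω → ℂ} (hf : Measurable f) {v : ℝ≥0}
    (h : P.map f = complexGaussian v) : MemLp f 2 P := by
  have := memLp_id_complexGaussian v
  rw [← h, memLp_map_measure_iff (by fun_prop) hf.aemeasurable] at this
  exact this

theorem integral_eq_zero_of_map_eq_complexGaussian {f : Ω → ℂ} (hf : Measurable f) {v : ℝ≥0}
    (h : P.map f = complexGaussian v) : ∫ ω, f ω ∂P = 0 := by
  have := integral_id_complexGaussian v
  rwa [← h, integral_map hf.aemeasurable (by fun_prop)] at this

theorem integral_norm_sq_of_map_eq_complexGaussian {f : Ω → ℂ} (hf : Measurable f) {v : ℝ≥0}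
    (h : P.map f = complexGaussian v) : ∫ ω, ‖f ω‖ ^ 2 ∂P = v := by
  have := integral_norm_sq_complexGaussian v
  rwa [← h, integral_map hf.aemeasurable (by fun_prop)] at this

theorem IsCircularGaussian.exists_map_eq (hX : IsCircularGaussian P X) (i : Fin n) :
    ∃ v, P.map (fun ω => X ω i) = complexGaussian v := by
  obtain ⟨v, hv⟩ := hX (Pi.single i 1)
  refine ⟨v, ?_⟩
  rw [← hv]
  congr 1
  funext ω
  simp [Pi.single_apply]

theorem IsCircularGaussian.memLp (hX : IsCircularGaussian P X) (hm : Measurable X) (i : Fin n) :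
    MemLp (fun ω => X ω i) 2 P :=
  memLp_of_map_eq_complexGaussian (by fun_prop) (hX.exists_map_eq i).choose_spec

theorem IsCircularGaussian.mulVec (hX : IsCircularGaussian P X) {m : ℕ}
    (B : Matrix (Fin m) (Fin n) ℂ) : IsCircularGaussian P (fun ω => B.mulVec (X ω)) := by
  intro c
  obtain ⟨v, hv⟩ := hX (Matrix.vecMul c B)
  refine ⟨v, ?_⟩
  rw [← hv]
  congr 1
  funext ω
  exact Matrix.dotProduct_mulVec c B (X ω)

/-- A law `CN(0, v)` is determined by its second moment, which the correlation matrix supplies. -/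
theorem IsCircularGaussian.map_sum_eq (hX : IsCircularGaussian P X) (hm : Measurable X)
    {d : Fin n → ℝ≥0} (hd : corrMatrix P X = Matrix.diagonal fun i => ((d i : ℝ) : ℂ))
    (c : Fin n → ℂ) :
    P.map (fun ω => ∑ i, c i * X ω i) = complexGaussian (∑ i, ‖c i‖₊ ^ 2 * d i) := by
  obtain ⟨v, hv⟩ := hX c
  rw [hv]
  congr 1
  have h1 := integral_norm_sq_of_map_eq_complexGaussian (by fun_prop) hv
  rw [integral_norm_sq_sum_of_corrMatrix_diagonal (hX.memLp hm) hd] at h1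
  apply NNReal.coe_injective
  rw [← h1]
  push_cast
  rfl

theorem IsCircularGaussian.map_apply_eq (hX : IsCircularGaussian P X) (hm : Measurable X)
    {d : Fin n → ℝ≥0} (hd : corrMatrix P X = Matrix.diagonal fun i => ((d i : ℝ) : ℂ))
    (i : Fin n) : P.map (fun ω => X ω i) = complexGaussian (d i) := by
  have h := hX.map_sum_eq hm hd (Pi.single i 1)
  have e1 : (fun ω => ∑ j, (Pi.single i 1 : Fin n → ℂ) j * X ω j) = fun ω => X ω i := by
    funext ω
    simp [Pi.single_apply]
  have e2 : ∑ j, ‖(Pi.single i 1 : Fin n → ℂ) j‖₊ ^ 2 * d j = d i := by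
    rw [Finset.sum_eq_single i]
    · simp
    · intro j _ hj
      simp [hj]
    · simp
  rwa [e1, e2] at h

/-- The joint characteristic function at `t` is that of the scalar `∑ conj(t_i) X_i` at `1`. Its
exponent is a sum over the coordinates, so it factorises. -/
theorem IsCircularGaussian.iIndepFun [IsProbabilityMeasure P] (hX : IsCircularGaussian P X)
    (hm : Measurable X) {d : Fin n → ℝ≥0}
    (hd : corrMatrix P X = Matrix.diagonal fun i => ((d i : ℝ) : ℂ)) :
    iIndepFun (fun i ω => X ω i) P := by
  rw [iIndepFun_iff_charFun_pi (fun i => by fun_prop)]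
  intro t
  have h1 : charFun (P.map fun ω => WithLp.toLp 2 (fun i => X ω i)) t =
      charFun (P.map fun ω => ∑ i, star (t i) * X ω i) 1 := by
    rw [charFun_apply, charFun_apply, integral_map (by fun_prop) (by fun_prop),
      integral_map (by fun_prop) (by fun_prop)]
    congr 1
    funext ω
    congr 3
    rw [PiLp.inner_apply, Complex.inner, one_mul, Complex.conj_re, Complex.re_sum]
    refine Finset.sum_congr rfl fun i _ => ?_
    rw [Complex.inner]
    simp
  rw [h1, hX.map_sum_eq hm hd, charFun_complexGaussian]
  simp_rw [hX.map_apply_eq hm hd, charFun_complexGaussian]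
  rw [← Complex.exp_sum]
  congr 1
  push_cast
  rw [Finset.sum_neg_distrib, ← Finset.sum_div]
  simp [mul_comm]

theorem IsCircularGaussian.lintegral_exp_sq [IsProbabilityMeasure P] (hX : IsCircularGaussian P X)
    (hm : Measurable X) {d : Fin n → ℝ≥0}
    (hd : corrMatrix P X = Matrix.diagonal fun i => ((d i : ℝ) : ℂ))
    {c : ℝ} (hc : 0 ≤ c) (u : Fin n → ℂ) :
    ∫⁻ ω, ENNReal.ofReal (Real.exp (∑ i, (-c * ‖X ω i‖ ^ 2 + 2 * (star (X ω i) * u i).re))) ∂P =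
      ENNReal.ofReal (Real.exp
        (∑ i, (d i * ‖u i‖ ^ 2 / (1 + c * d i) - Real.log (1 + c * d i)))) := by
  have hpos : ∀ i, 0 < 1 + c * d i := fun i => by positivity
  simp_rw [Real.exp_sum]
  simp_rw [ENNReal.ofReal_prod_of_nonneg fun i _ => (Real.exp_pos _).le]
  have hind := (hX.iIndepFun hm hd).comp (fun i z => ENNReal.ofReal
    (Real.exp (-c * ‖z‖ ^ 2 + 2 * (star z * u i).re))) (fun i => by fun_prop)
  refine (lintegral_prod_eq_prod_lintegral_of_indepFun Finset.univ _ hind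
    (fun i => by fun_prop)).trans ?_
  refine Finset.prod_congr rfl fun i _ => ?_
  have h := lintegral_complexGaussian_exp_sq (d i) hc (u i)
  rw [← hX.map_apply_eq hm hd i, lintegral_map (by fun_prop) (by fun_prop)] at h
  refine h.trans ?_
  rw [Real.exp_sub, Real.exp_log (hpos i), div_eq_inv_mul (Real.exp _)]

end Circular

/-! ### Translated noise and the density of the echo -/

/-- The Cameron-Martin formula for a vector. On rectangles, independence factorises both sides into
the scalar formula; rectangles form a generating π-system. -/
theorem lintegral_noise_add {Ω : Type*} [MeasurableSpace Ω] {P : Measure Ω}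
    {ι : Type*} [Fintype ι] {N : Ω → ι → ℂ}
    (hN : Measurable N) (hind : iIndepFun (fun i ω => N ω i) P) {v : ℝ≥0} (hv : v ≠ 0)
    (hlaw : ∀ i, P.map (fun ω => N ω i) = complexGaussian v) (d : ι → ℂ) {f : (ι → ℂ) → ℝ≥0∞}
    (hf : Measurable f) :
    ∫⁻ ω, f (N ω + d) ∂P =
      ∫⁻ ω, f (N ω) * ENNReal.ofReal (Real.exp
        (∑ i, (2 * (star (d i) * N ω i).re - ‖d i‖ ^ 2) / v)) ∂P := by
  have : IsProbabilityMeasure P := hind.isProbabilityMeasure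
  set w : ι → ℂ → ℝ≥0∞ := fun i z =>
    ENNReal.ofReal (Real.exp ((2 * (star (d i) * z).re - ‖d i‖ ^ 2) / v))
  have hwm : ∀ i, Measurable (w i) := fun i => by fun_prop
  have hwprod : ∀ ω, ENNReal.ofReal (Real.exp
      (∑ i, (2 * (star (d i) * N ω i).re - ‖d i‖ ^ 2) / v)) = ∏ i, w i (N ω i) := by
    intro ω
    rw [Real.exp_sum, ENNReal.ofReal_prod_of_nonneg fun i _ => (Real.exp_pos _).le]
  have hmeas : P.map (fun ω => N ω + d) =
      (P.withDensity (fun ω => ∏ i, w i (N ω i))).map N := by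
    have hrect : ∀ (A : ι → Set ℂ), (∀ i, MeasurableSet (A i)) →
        (P.map (fun ω => N ω + d)) (Set.univ.pi A) =
        ((P.withDensity (fun ω => ∏ i, w i (N ω i))).map N) (Set.univ.pi A) := by
      intro A hA
      have hAi : ∀ i, Measurable ((A i).indicator (1 : ℂ → ℝ≥0∞)) :=
        fun i => measurable_one.indicator (hA i)
      have hAm := MeasurableSet.univ_pi hA
      have hAN : Measurable ((Set.univ.pi A).indicator (1 : (ι → ℂ) → ℝ≥0∞)) :=
        measurable_one.indicator hAm
      have hprod : ∀ y : ι → ℂ, (Set.univ.pi A).indicator (1 : (ι → ℂ) → ℝ≥0∞) y =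
          ∏ i, (A i).indicator (1 : ℂ → ℝ≥0∞) (y i) := by
        intro y
        classical
        simp only [Set.indicator_apply, Set.mem_univ_pi, Pi.one_apply, Finset.prod_ite_zero,
          Finset.mem_univ, forall_const, Finset.prod_const_one]
      have hshift := hind.comp (fun i z => (A i).indicator (1 : ℂ → ℝ≥0∞) (z + d i))
        (fun i => by fun_prop)
      have hdens := hind.comp (fun i z => (A i).indicator (1 : ℂ → ℝ≥0∞) z * w i z)
        (fun i => by fun_prop)
      have e1 : (P.map (fun ω => N ω + d)) (Set.univ.pi A) =
          ∫⁻ ω, ∏ i, (A i).indicator (1 : ℂ → ℝ≥0∞) (N ω i + d i) ∂P := by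
        rw [← lintegral_indicator_one hAm, lintegral_map hAN (by fun_prop)]
        exact lintegral_congr fun ω => hprod _
      have e2 : ((P.withDensity (fun ω => ∏ i, w i (N ω i))).map N) (Set.univ.pi A) =
          ∫⁻ ω, ∏ i, ((A i).indicator (1 : ℂ → ℝ≥0∞) (N ω i) * w i (N ω i)) ∂P := by
        rw [← lintegral_indicator_one hAm, lintegral_map hAN hN,
          lintegral_withDensity_eq_lintegral_mul _ (by fun_prop) (by fun_prop)]
        refine lintegral_congr fun ω => ?_
        rw [Finset.prod_mul_distrib, Pi.mul_apply, mul_comm, hprod]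
      rw [e1, e2]
      refine (lintegral_prod_eq_prod_lintegral_of_indepFun Finset.univ _ hshift
        (fun i => by fun_prop)).trans (Eq.trans ?_
        (lintegral_prod_eq_prod_lintegral_of_indepFun Finset.univ _ hdens
          (fun i => by fun_prop)).symm)
      refine Finset.prod_congr rfl fun i _ => ?_
      have h := lintegral_complexGaussian_add hv (d i) (hAi i)
      rw [← hlaw i, lintegral_map (by fun_prop) (by fun_prop),
        lintegral_map (by fun_prop) (by fun_prop)] at h
      exact h
    have : IsFiniteMeasure (P.map (fun ω => N ω + d)) := by infer_instance
    refine MeasureTheory.ext_of_generate_finite _ generateFrom_pi.symm isPiSystem_pi ?_ ?_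
    · rintro _ ⟨A, hA, rfl⟩
      exact hrect A fun i => hA i (Set.mem_univ i)
    · have := hrect (fun _ => Set.univ) fun _ => MeasurableSet.univ
      rwa [Set.pi_univ] at this
  have h1 := lintegral_map (μ := P) hf (g := fun ω => N ω + d) (by fun_prop)
  rw [← h1, hmeas, lintegral_map hf hN,
    lintegral_withDensity_eq_lintegral_mul _ (by fun_prop) (by fun_prop)]
  refine lintegral_congr fun ω => ?_
  rw [hwprod, Pi.mul_apply, mul_comm]

/-- The output `Y x̄` of the filter matched to the waveform `x`. -/
noncomputable def matchedFilter {M L : ℕ} (x : Fin L → ℂ) (y : Fin M → Fin L → ℂ) : Fin M → ℂ :=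
  fun m => ∑ l, y m l * star (x l)

/-- The log-density of the echo `y`, given the waveform `x` and the response `g`, with respect to
the law of white Gaussian noise of variance `v`, in the coordinates given by the unitary `B`. -/
noncomputable def echoLogDensity {M L : ℕ} (v : ℝ) (B : Matrix (Fin M) (Fin M) ℂ)
    (w : (Fin L → ℂ) × ((Fin M → Fin L → ℂ) × (Fin M → ℂ))) : ℝ :=
  ∑ i, (-((∑ l, ‖w.1 l‖ ^ 2) / v) * ‖B.mulVec w.2.2 i‖ ^ 2 +
    2 * (star (B.mulVec w.2.2 i) * (B.mulVec (matchedFilter w.1 w.2.1) i / v)).re)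

/-- The log-density of the echo `y`, given the waveform `x`, with respect to the law of white
Gaussian noise of variance `v`, when the response has independent coordinates of variances `d i` in
the coordinates given by the unitary `B`. -/
noncomputable def echoMarginalLogDensity {M L : ℕ} (v : ℝ) (B : Matrix (Fin M) (Fin M) ℂ)
    (d : Fin M → ℝ) (w : (Fin L → ℂ) × (Fin M → Fin L → ℂ)) : ℝ :=
  ∑ i, (d i * ‖B.mulVec (matchedFilter w.1 w.2) i / v‖ ^ 2 / (1 + (∑ l, ‖w.1 l‖ ^ 2) / v * d i) -
    Real.log (1 + (∑ l, ‖w.1 l‖ ^ 2) / v * d i))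

theorem measurable_mulVec {M : ℕ} (B : Matrix (Fin M) (Fin M) ℂ) :
    Measurable fun w : Fin M → ℂ => B.mulVec w := by
  unfold Matrix.mulVec dotProduct
  fun_prop

theorem measurable_echoLogDensity {M L : ℕ} (v : ℝ) (B : Matrix (Fin M) (Fin M) ℂ) :
    Measurable (echoLogDensity (L := L) v B) := by
  unfold echoLogDensity matchedFilter Matrix.mulVec dotProduct
  fun_prop

theorem measurable_echoMarginalLogDensity {M L : ℕ} (v : ℝ) (B : Matrix (Fin M) (Fin M) ℂ)
    (d : Fin M → ℝ) : Measurable (echoMarginalLogDensity (L := L) v B d) := by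
  unfold echoMarginalLogDensity matchedFilter Matrix.mulVec dotProduct
  fun_prop

theorem sum_star_mulVec_mul_mulVec {M : ℕ} {B : Matrix (Fin M) (Fin M) ℂ}
    (hB : B.conjTranspose * B = 1) (a b : Fin M → ℂ) :
    ∑ i, star (B.mulVec a i) * B.mulVec b i = ∑ m, star (a m) * b m := by
  have h : star (B.mulVec a) ⬝ᵥ B.mulVec b = star a ⬝ᵥ b := by
    rw [Matrix.star_mulVec, ← Matrix.dotProduct_mulVec, Matrix.mulVec_mulVec, hB, Matrix.one_mulVec]
  exact h

theorem sum_norm_sq_mulVec {M : ℕ} {B : Matrix (Fin M) (Fin M) ℂ}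
    (hB : B.conjTranspose * B = 1) (a : Fin M → ℂ) :
    ∑ i, ‖B.mulVec a i‖ ^ 2 = ∑ m, ‖a m‖ ^ 2 := by
  have h := sum_star_mulVec_mul_mulVec hB a a
  simp only [RCLike.star_def, Complex.conj_mul'] at h
  exact_mod_cast h

/-- A unitary preserves inner products, so the choice of `B` is immaterial and the entrywise
Cameron-Martin exponent for the shift `g xᵀ` is recovered. -/
theorem echoLogDensity_eq {M L : ℕ} {v : ℝ} {B : Matrix (Fin M) (Fin M) ℂ}
    (hB : B.conjTranspose * B = 1) (x : Fin L → ℂ) (y : Fin M → Fin L → ℂ) (g : Fin M → ℂ) :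
    echoLogDensity v B (x, (y, g)) =
      ∑ ml : Fin M × Fin L,
        (2 * (star (g ml.1 * x ml.2) * y ml.1 ml.2).re - ‖g ml.1 * x ml.2‖ ^ 2) / v := by
  have h1 : ∑ ml : Fin M × Fin L, ‖g ml.1 * x ml.2‖ ^ 2 = (∑ l, ‖x l‖ ^ 2) * ∑ m, ‖g m‖ ^ 2 := by
    rw [Fintype.sum_prod_type, Finset.sum_mul_sum, Finset.sum_comm]
    simp only [norm_mul, mul_pow, mul_comm]
  have h2 : ∑ ml : Fin M × Fin L, star (g ml.1 * x ml.2) * y ml.1 ml.2 =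
      ∑ m, star (g m) * matchedFilter x y m := by
    rw [Fintype.sum_prod_type]
    refine Finset.sum_congr rfl fun m _ => ?_
    rw [matchedFilter, Finset.mul_sum]
    refine Finset.sum_congr rfl fun l _ => ?_
    rw [star_mul']
    ring
  have h3 : ∀ z : ℂ, (z / (v : ℂ)).re = z.re / v := fun z => by
    rw [Complex.div_ofReal_re]
  rw [← Finset.sum_div, Finset.sum_sub_distrib, ← Finset.mul_sum, ← Complex.re_sum, h1, h2,
    ← sum_norm_sq_mulVec hB, ← sum_star_mulVec_mul_mulVec hB, echoLogDensity,
    Finset.sum_add_distrib, ← Finset.mul_sum, ← Finset.mul_sum]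
  simp_rw [← mul_div_assoc, h3]
  rw [← Finset.sum_div, Complex.re_sum]
  ring

theorem map_echoSignal_eq_withDensity {Ω : Type*} [MeasurableSpace Ω] {P : Measure Ω}
    [IsProbabilityMeasure P] {M L : ℕ} {g : Ω → Fin M → ℂ} {x : Ω → Fin L → ℂ}
    {N : Ω → Fin M → Fin L → ℂ} (hg : Measurable g) (hx : Measurable x) (hN : Measurable N)
    (hgN : IndepFun g N P) (hxgN : IndepFun x (fun ω => (g ω, N ω)) P)
    (hN_indep : iIndepFun (fun (ml : Fin M × Fin L) (ω : Ω) => N ω ml.1 ml.2) P)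
    {v : ℝ≥0} (hv : v ≠ 0) (hN_law : ∀ m l, P.map (fun ω => N ω m l) = complexGaussian v)
    {B : Matrix (Fin M) (Fin M) ℂ} (hB : B.conjTranspose * B = 1) :
    P.map (fun ω => (x ω, (echoSignal g x N ω, g ω))) =
      ((P.map x).prod ((P.map N).prod (P.map g))).withDensity
        (fun w => ENNReal.ofReal (Real.exp (echoLogDensity v B w))) := by
  have := Measure.isProbabilityMeasure_map (μ := P) hg.aemeasurable
  have := Measure.isProbabilityMeasure_map (μ := P) hx.aemeasurable
  have := Measure.isProbabilityMeasure_map (μ := P) hN.aemeasurable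
  have hr := measurable_echoLogDensity (L := L) v B
  have hlaw : P.map (fun ω => (x ω, (g ω, N ω))) =
      (P.map x).prod ((P.map g).prod (P.map N)) := by
    rw [(indepFun_iff_map_prod_eq_prod_map_map hx.aemeasurable (by fun_prop)).1 hxgN,
      (indepFun_iff_map_prod_eq_prod_map_map hg.aemeasurable hN.aemeasurable).1 hgN]
  have hshift : ∀ (x : Fin L → ℂ) (g : Fin M → ℂ) (f : (Fin M → Fin L → ℂ) → ℝ≥0∞),
      Measurable f → ∫⁻ n, f (fun m l => g m * x l + n m l) ∂(P.map N) =
        ∫⁻ n, f n * ENNReal.ofReal (Real.exp (echoLogDensity v B (x, (n, g)))) ∂(P.map N) := by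
    intro x g f hf
    have hm : Measurable fun n : Fin M → Fin L → ℂ => echoLogDensity v B (x, (n, g)) :=
      hr.comp (by fun_prop)
    rw [lintegral_map (by fun_prop) hN, lintegral_map (by fun_prop) hN]
    have h := lintegral_noise_add (N := fun ω (ml : Fin M × Fin L) => N ω ml.1 ml.2)
      (by fun_prop) hN_indep hv (fun ml => hN_law ml.1 ml.2) (fun ml => g ml.1 * x ml.2)
      (f := fun n => f (fun m l => n (m, l))) (by fun_prop)
    simp_rw [echoLogDensity_eq hB]
    refine Eq.trans (lintegral_congr fun ω => ?_) h
    congr 1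
    funext m l
    exact add_comm _ _
  refine Measure.ext_of_lintegral _ fun f hf => ?_
  have hΦ : Measurable fun w : (Fin L → ℂ) × ((Fin M → ℂ) × (Fin M → Fin L → ℂ)) =>
      (w.1, ((fun m l => w.2.1 m * w.1 l + w.2.2 m l : Fin M → Fin L → ℂ), w.2.1)) := by
    fun_prop
  have hΦ' : (fun ω => (x ω, (echoSignal g x N ω, g ω))) =
      (fun w : (Fin L → ℂ) × ((Fin M → ℂ) × (Fin M → Fin L → ℂ)) =>
        (w.1, ((fun m l => w.2.1 m * w.1 l + w.2.2 m l : Fin M → Fin L → ℂ), w.2.1))) ∘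
      (fun ω => (x ω, (g ω, N ω))) := rfl
  rw [hΦ', ← Measure.map_map hΦ (by fun_prop), hlaw, lintegral_map hf hΦ,
    lintegral_withDensity_eq_lintegral_mul _ (by fun_prop) hf,
    lintegral_prod _ (by fun_prop), lintegral_prod _ (by fun_prop)]
  refine lintegral_congr fun x => ?_
  -- The reference measure lists the noise before `g`; the order is swapped so that `g` is fixed
  -- when the noise is translated.
  rw [lintegral_prod _ (by fun_prop), lintegral_prod_symm _ (by fun_prop)]
  refine lintegral_congr fun g => ?_
  rw [hshift x g (fun n => f (x, (n, g))) (by fun_prop)]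
  refine lintegral_congr fun n => ?_
  rw [Pi.mul_apply, mul_comm]

theorem echoSignal_matchedFilter {Ω : Type*} {M L : ℕ} (g : Ω → Fin M → ℂ) (x : Ω → Fin L → ℂ)
    (N : Ω → Fin M → Fin L → ℂ) (B : Matrix (Fin M) (Fin M) ℂ) (ω : Ω) (i : Fin M) :
    B.mulVec (matchedFilter (x ω) (echoSignal g x N ω)) i =
      ((∑ l, ‖x ω l‖ ^ 2 : ℝ) : ℂ) * B.mulVec (g ω) i +
        B.mulVec (matchedFilter (x ω) (N ω)) i := by
  have h : matchedFilter (x ω) (echoSignal g x N ω) =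
      ((∑ l, ‖x ω l‖ ^ 2 : ℝ) : ℂ) • g ω + matchedFilter (x ω) (N ω) := by
    funext m
    simp only [matchedFilter, echoSignal, add_mul, Finset.sum_add_distrib, Pi.add_apply,
      Pi.smul_apply, smul_eq_mul]
    congr 1
    push_cast
    rw [Finset.sum_mul]
    refine Finset.sum_congr rfl fun l _ => ?_
    rw [mul_assoc, RCLike.star_def, Complex.mul_conj', mul_comm]
  rw [h, Matrix.mulVec_add, Matrix.mulVec_smul]
  rfl

theorem memLp_mulVec {Ω : Type*} [MeasurableSpace Ω] {P : Measure Ω} {M : ℕ} {X : Ω → Fin M → ℂ}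
    (hX : ∀ m, MemLp (fun ω => X ω m) 2 P) (B : Matrix (Fin M) (Fin M) ℂ) (i : Fin M) :
    MemLp (fun ω => B.mulVec (X ω) i) 2 P :=
  memLp_finsetSum Finset.univ (f := fun m ω => B i m * X ω m) fun m _ => (hX m).const_mul _

/-! ### Second moments of the filtered noise -/

section Moments

variable {Ω : Type*} [MeasurableSpace Ω] {P : Measure Ω} {M L : ℕ}
  {x : Ω → Fin L → ℂ} {N : Ω → Fin M → Fin L → ℂ} {v : ℝ≥0} {E : ℝ}

theorem ae_norm_le_sqrt (hE : ∀ᵐ ω ∂P, ∑ l, ‖x ω l‖ ^ 2 = E) (l : Fin L) :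
    ∀ᵐ ω ∂P, ‖x ω l‖ ≤ √E := by
  filter_upwards [hE] with ω hω
  rw [← hω]
  exact Real.le_sqrt_of_sq_le
    (Finset.single_le_sum (f := fun l => ‖x ω l‖ ^ 2) (fun _ _ => by positivity) (Finset.mem_univ l))

theorem memLp_matchedFilter (hx : Measurable x) (hN : Measurable N)
    (hN_law : ∀ m l, P.map (fun ω => N ω m l) = complexGaussian v)
    (hE : ∀ᵐ ω ∂P, ∑ l, ‖x ω l‖ ^ 2 = E) (m : Fin M) :
    MemLp (fun ω => matchedFilter (x ω) (N ω) m) 2 P := by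
  refine memLp_finsetSum _ fun l _ => ?_
  refine (memLp_of_map_eq_complexGaussian (by fun_prop) (hN_law m l)).of_le_mul (c := √E)
    (by fun_prop) ?_
  filter_upwards [ae_norm_le_sqrt hE l] with ω hω
  rw [norm_mul, norm_star, mul_comm]
  gcongr

theorem integral_noise_mul_conj (hN : Measurable N)
    (hN_indep : iIndepFun (fun (ml : Fin M × Fin L) (ω : Ω) => N ω ml.1 ml.2) P)
    (hN_law : ∀ m l, P.map (fun ω => N ω m l) = complexGaussian v) (a b : Fin M × Fin L) :
    ∫ ω, N ω a.1 a.2 * (starRingEnd ℂ) (N ω b.1 b.2) ∂P = if a = b then (v : ℂ) else 0 := by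
  split_ifs with h
  · subst h
    simp_rw [Complex.mul_conj', ← Complex.ofReal_pow]
    rw [integral_complex_ofReal,
      integral_norm_sq_of_map_eq_complexGaussian (by fun_prop) (hN_law a.1 a.2)]
  · have hi := (hN_indep.indepFun h).comp (φ := id) (ψ := starRingEnd ℂ) measurable_id
      Complex.continuous_conj.measurable
    refine (hi.integral_mul_eq_mul_integral (by fun_prop) (by fun_prop)).trans ?_
    have := integral_eq_zero_of_map_eq_complexGaussian (by fun_prop) (hN_law a.1 a.2)
    simp only [Function.comp_def, id, this, zero_mul]

/-- Noise and waveform moments separate by independence. White noise keeps only the terms with equal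
indices, whose waveform factors add up to the energy `E`. -/
theorem corrMatrix_matchedFilter [IsProbabilityMeasure P] (hx : Measurable x) (hN : Measurable N) (hxN : IndepFun x N P)
    (hN_indep : iIndepFun (fun (ml : Fin M × Fin L) (ω : Ω) => N ω ml.1 ml.2) P)
    (hN_law : ∀ m l, P.map (fun ω => N ω m l) = complexGaussian v)
    (hE : ∀ᵐ ω ∂P, ∑ l, ‖x ω l‖ ^ 2 = E) :
    corrMatrix P (fun ω => matchedFilter (x ω) (N ω)) = ((v * E : ℝ) : ℂ) • 1 := by
  have hN2 := fun m l => memLp_of_map_eq_complexGaussian (by fun_prop) (hN_law m l)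
  have hx2 : ∀ l, MemLp (fun ω => x ω l) 2 P := fun l =>
    MemLp.of_bound (by fun_prop) (√E) (ae_norm_le_sqrt hE l)
  have hind : ∀ m l m' l', IndepFun (fun ω => N ω m l * (starRingEnd ℂ) (N ω m' l'))
      (fun ω => x ω l' * (starRingEnd ℂ) (x ω l)) P := fun m l m' l' =>
    hxN.symm.comp (φ := fun n : Fin M → Fin L → ℂ => n m l * (starRingEnd ℂ) (n m' l'))
      (ψ := fun y : Fin L → ℂ => y l' * (starRingEnd ℂ) (y l))
      (by fun_prop) (by fun_prop)
  have hint : ∀ m l m' l', Integrable (fun ω => (N ω m l * (starRingEnd ℂ) (N ω m' l')) *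
      (x ω l' * (starRingEnd ℂ) (x ω l))) P := fun m l m' l' =>
    (hind m l m' l').integrable_mul ((hN2 m l).integrable_mul_conj (hN2 m' l'))
      ((hx2 l').integrable_mul_conj (hx2 l))
  have hval : ∀ m l m' l', ∫ ω, (N ω m l * (starRingEnd ℂ) (N ω m' l')) *
      (x ω l' * (starRingEnd ℂ) (x ω l)) ∂P = (if (m, l) = (m', l') then (v : ℂ) else 0) *
        ∫ ω, x ω l' * (starRingEnd ℂ) (x ω l) ∂P := fun m l m' l' => by
    rw [← integral_noise_mul_conj hN hN_indep hN_law (m, l) (m', l')]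
    exact (hind m l m' l').integral_mul_eq_mul_integral (by fun_prop) (by fun_prop)
  ext m m'
  simp only [corrMatrix, Matrix.of_apply, matchedFilter, map_sum, map_mul, Matrix.smul_apply,
    Finset.sum_mul_sum, RCLike.star_def, Complex.conj_conj]
  have hre : ∀ ω l l', N ω m l * (starRingEnd ℂ) (x ω l) *
      ((starRingEnd ℂ) (N ω m' l') * x ω l') = (N ω m l * (starRingEnd ℂ) (N ω m' l')) *
      (x ω l' * (starRingEnd ℂ) (x ω l)) := fun ω l l' => by ring
  simp_rw [hre]
  rw [integral_finsetSum _ fun l _ => integrable_finsetSum _ fun l' _ => hint m l m' l']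
  simp_rw [fun l => integral_finsetSum (μ := P) Finset.univ
    (f := fun l' ω => (N ω m l * (starRingEnd ℂ) (N ω m' l')) * (x ω l' * (starRingEnd ℂ) (x ω l)))
    fun l' _ => hint m l m' l', hval]
  by_cases hm : m = m'
  · subst hm
    simp only [Prod.mk.injEq, true_and, ite_mul, zero_mul, Finset.sum_ite_eq, Finset.mem_univ,
      if_true, Matrix.one_apply_eq, smul_eq_mul, mul_one]
    rw [← Finset.mul_sum, ← integral_finsetSum _ fun l _ => (hx2 l).integrable_mul_conj (hx2 l)]
    have : ∀ᵐ ω ∂P, ∑ l, x ω l * (starRingEnd ℂ) (x ω l) = (E : ℂ) := by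
      filter_upwards [hE] with ω hω
      simp_rw [Complex.mul_conj', ← hω]
      push_cast
      rfl
    rw [integral_congr_ae this]
    simp
  · simp [hm]

theorem integral_conj_mul_matchedFilter [IsProbabilityMeasure P] {g : Ω → Fin M → ℂ} (hg : Measurable g)
    (hx : Measurable x) (hN : Measurable N) (hgN : IndepFun g N P)
    (hxgN : IndepFun x (fun ω => (g ω, N ω)) P)
    (hN_law : ∀ m l, P.map (fun ω => N ω m l) = complexGaussian v)
    (hE : ∀ᵐ ω ∂P, ∑ l, ‖x ω l‖ ^ 2 = E) (hg2 : ∀ m, MemLp (fun ω => g ω m) 2 P)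
    (B : Matrix (Fin M) (Fin M) ℂ) (i : Fin M) :
    ∫ ω, B.mulVec (matchedFilter (x ω) (N ω)) i * (starRingEnd ℂ) (B.mulVec (g ω) i) ∂P = 0 := by
  have hN2 := fun m l => memLp_of_map_eq_complexGaussian (by fun_prop) (hN_law m l)
  have hx2 : ∀ l, MemLp (fun ω => x ω l) 2 P := fun l =>
    MemLp.of_bound (by fun_prop) (√E) (ae_norm_le_sqrt hE l)
  have hBm := measurable_mulVec B
  have hBg : MemLp (fun ω => B.mulVec (g ω) i) 2 P :=
    memLp_mulVec hg2 B i
  have hi1 : ∀ m l, IndepFun (fun ω => star (x ω l))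
      (fun ω => N ω m l * (starRingEnd ℂ) (B.mulVec (g ω) i)) P := fun m l =>
    hxgN.comp (φ := fun x : Fin L → ℂ => star (x l))
      (ψ := fun p : (Fin M → ℂ) × (Fin M → Fin L → ℂ) =>
        p.2 m l * (starRingEnd ℂ) (B.mulVec p.1 i)) (by fun_prop) (by fun_prop)
  have hi2 : ∀ m l, IndepFun (fun ω => N ω m l)
      (fun ω => (starRingEnd ℂ) (B.mulVec (g ω) i)) P := fun m l =>
    hgN.symm.comp (φ := fun n : Fin M → Fin L → ℂ => n m l)
      (ψ := fun p : Fin M → ℂ => (starRingEnd ℂ) (B.mulVec p i)) (by fun_prop) (by fun_prop)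
  have hval : ∀ m l, ∫ ω, star (x ω l) * (N ω m l * (starRingEnd ℂ) (B.mulVec (g ω) i)) ∂P = 0 := by
    intro m l
    refine ((hi1 m l).integral_mul_eq_mul_integral (by fun_prop) (by fun_prop)).trans ?_
    have h2 : ∫ ω, N ω m l * (starRingEnd ℂ) (B.mulVec (g ω) i) ∂P = 0 := by
      refine ((hi2 m l).integral_mul_eq_mul_integral (by fun_prop) (by fun_prop)).trans ?_
      rw [integral_eq_zero_of_map_eq_complexGaussian (by fun_prop) (hN_law m l), zero_mul]
    rw [h2, mul_zero]
  have hint : ∀ m l, Integrable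
      (fun ω => star (x ω l) * (N ω m l * (starRingEnd ℂ) (B.mulVec (g ω) i))) P := fun m l =>
    (hi1 m l).integrable_mul ((hx2 l).star.integrable (by norm_num))
      ((hN2 m l).integrable_mul_conj hBg)
  have he : ∀ ω, B.mulVec (matchedFilter (x ω) (N ω)) i * (starRingEnd ℂ) (B.mulVec (g ω) i) =
      ∑ m, B i m * ∑ l, star (x ω l) * (N ω m l * (starRingEnd ℂ) (B.mulVec (g ω) i)) := by
    intro ω
    rw [Matrix.mulVec, dotProduct, Finset.sum_mul]
    refine Finset.sum_congr rfl fun m _ => ?_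
    rw [matchedFilter, mul_assoc, Finset.sum_mul]
    congr 1
    refine Finset.sum_congr rfl fun l _ => ?_
    ring
  simp_rw [he]
  rw [integral_finsetSum _ fun m _ => (integrable_finsetSum _ fun l _ => hint m l).const_mul _]
  refine Finset.sum_eq_zero fun m _ => ?_
  rw [integral_const_mul, integral_finsetSum _ fun l _ => hint m l]
  simp_rw [hval, Finset.sum_const_zero, mul_zero]

end Moments

/-! ### The scalar channel -/

section Integral

variable {Ω : Type*} [MeasurableSpace Ω] {P : Measure Ω} [IsProbabilityMeasure P]

/-- The mutual information of a scalar Gaussian channel, as the mean of its information density. -/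
theorem integral_scalar_information_density {G W : Ω → ℂ} (hG : MemLp G 2 P) (hW : MemLp W 2 P)
    {v d E : ℝ} (hv : 0 < v) (hd : 0 ≤ d) (hE : 0 ≤ E)
    (hGd : ∫ ω, ‖G ω‖ ^ 2 ∂P = d) (hWd : ∫ ω, ‖W ω‖ ^ 2 ∂P = v * E)
    (hWG : ∫ ω, W ω * (starRingEnd ℂ) (G ω) ∂P = 0) :
    Integrable (fun ω => -(E / v) * ‖G ω‖ ^ 2 + 2 * (star (G ω) * ((E * G ω + W ω) / v)).re -
      (d * ‖(E * G ω + W ω) / v‖ ^ 2 / (1 + E / v * d) - Real.log (1 + E / v * d))) P ∧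
    ∫ ω, (-(E / v) * ‖G ω‖ ^ 2 + 2 * (star (G ω) * ((E * G ω + W ω) / v)).re -
      (d * ‖(E * G ω + W ω) / v‖ ^ 2 / (1 + E / v * d) - Real.log (1 + E / v * d))) ∂P =
      Real.log (1 + E / v * d) := by
  have hpos : 0 < 1 + E / v * d := by positivity
  have hvd : v + E * d ≠ 0 := by positivity
  -- In this expansion the cross term has mean zero, and the two square terms have opposite means `±
  -- E d / (v + E d)`. No Gaussianity is needed.
  have hre : ∀ ω, -(E / v) * ‖G ω‖ ^ 2 + 2 * (star (G ω) * ((E * G ω + W ω) / v)).re -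
      (d * ‖(E * G ω + W ω) / v‖ ^ 2 / (1 + E / v * d) - Real.log (1 + E / v * d)) =
      E / (v + E * d) * ‖G ω‖ ^ 2 + 2 / (v + E * d) * (W ω * (starRingEnd ℂ) (G ω)).re +
        -(d / (v * (v + E * d))) * ‖W ω‖ ^ 2 + Real.log (1 + E / v * d) := by
    intro ω
    have h1 : (star (G ω) * ((E * G ω + W ω) / v)).re =
        (E * ‖G ω‖ ^ 2 + (W ω * (starRingEnd ℂ) (G ω)).re) / v := by
      rw [← mul_div_assoc, Complex.div_ofReal_re, Complex.sq_norm, Complex.normSq_apply]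
      simp
      ring
    have h2 : ‖(E * G ω + W ω) / v‖ ^ 2 =
        (E ^ 2 * ‖G ω‖ ^ 2 + 2 * E * (W ω * (starRingEnd ℂ) (G ω)).re + ‖W ω‖ ^ 2) / v ^ 2 := by
      rw [norm_div, div_pow]
      simp only [Complex.sq_norm, Complex.normSq_apply]
      simp
      ring
    rw [h1, h2]
    field_simp
    ring
  have i1 := (hG.norm.integrable_sq).const_mul (E / (v + E * d))
  have i2 := ((hW.integrable_mul_conj hG).re).const_mul (2 / (v + E * d))
  have i3 := (hW.norm.integrable_sq).const_mul (-(d / (v * (v + E * d))))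
  have hz : ∫ ω, (W ω * (starRingEnd ℂ) (G ω)).re ∂P = 0 := by
    have := integral_re (hW.integrable_mul_conj hG)
    rw [hWG] at this
    simpa using this
  simp_rw [hre]
  refine ⟨((i1.add i2).add i3).add (integrable_const _), ?_⟩
  rw [integral_add, integral_add, integral_add, integral_const_mul, integral_const_mul,
    integral_const_mul, hGd, hWd, hz, integral_const]
  · simp
    field_simp
    ring
  · exact i1
  · exact i2
  · exact i1.add i2
  · exact i3
  · exact (i1.add i2).add i3
  · exact integrable_const _

end Integral

/-! ### Diagonalisation and the sensing mutual information -/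

theorem exists_unitary_corrMatrix_mulVec_eq_diagonal {Ω : Type*} [MeasurableSpace Ω]
    {P : Measure Ω} {M : ℕ} {g : Ω → Fin M → ℂ} (hg2 : ∀ m, MemLp (fun ω => g ω m) 2 P) :
    ∃ B : Matrix (Fin M) (Fin M) ℂ, B.conjTranspose * B = 1 ∧ B * B.conjTranspose = 1 ∧
      corrMatrix P (fun ω => B.mulVec (g ω)) =
        Matrix.diagonal fun i => ((corrMatrix_isHermitian P g).eigenvalues i : ℂ) := by
  set h := corrMatrix_isHermitian P g
  have hU := Matrix.mem_unitaryGroup_iff.1 h.eigenvectorUnitary.2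
  have hU' := Matrix.mem_unitaryGroup_iff'.1 h.eigenvectorUnitary.2
  refine ⟨star (h.eigenvectorUnitary : Matrix (Fin M) (Fin M) ℂ), ?_, ?_, ?_⟩
  · rw [← Matrix.star_eq_conjTranspose, star_star]
    exact hU
  · rw [← Matrix.star_eq_conjTranspose, star_star]
    exact hU'
  · rw [corrMatrix_mulVec hg2]
    have := h.conjStarAlgAut_star_eigenvectorUnitary
    rw [Unitary.conjStarAlgAut_apply] at this
    exact this

theorem integral_norm_sq_of_corrMatrix_eq {Ω : Type*} [MeasurableSpace Ω]
    {P : Measure Ω} {M : ℕ} {g : Ω → Fin M → ℂ} {i : Fin M} {d : ℝ}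
    (h : corrMatrix P g i i = (d : ℂ)) : ∫ ω, ‖g ω i‖ ^ 2 ∂P = d := by
  simp only [corrMatrix, Matrix.of_apply, Complex.mul_conj', ← Complex.ofReal_pow] at h
  rw [integral_complex_ofReal] at h
  exact_mod_cast h

/-- Each eigenvalue is the second moment of a coordinate of `B g`. -/
theorem corrMatrix_eigenvalues_nonneg {Ω : Type*} [MeasurableSpace Ω]
    {P : Measure Ω} {M : ℕ} {g : Ω → Fin M → ℂ} (hg2 : ∀ m, MemLp (fun ω => g ω m) 2 P)
    (i : Fin M) : 0 ≤ (corrMatrix_isHermitian P g).eigenvalues i := by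
  obtain ⟨B, -, -, hB⟩ := exists_unitary_corrMatrix_mulVec_eq_diagonal hg2
  have h := integral_norm_sq_of_corrMatrix_eq (g := fun ω => B.mulVec (g ω))
    (by rw [hB, Matrix.diagonal_apply_eq] : _ = (((corrMatrix_isHermitian P g).eigenvalues i : ℝ) : ℂ))
  exact h ▸ integral_nonneg fun ω => by positivity

/-- The sensing mutual information of the echo of a waveform of constant energy `E`. -/
theorem condMutualInfo_echoSignal {Ω : Type*} [MeasurableSpace Ω] {P : Measure Ω}
    [IsProbabilityMeasure P] {M L : ℕ} {g : Ω → Fin M → ℂ} {x : Ω → Fin L → ℂ}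
    {N : Ω → Fin M → Fin L → ℂ} (hg : Measurable g) (hx : Measurable x) (hN : Measurable N)
    (hgc : IsCircularGaussian P g)
    (hgN : IndepFun g N P) (hxgN : IndepFun x (fun ω => (g ω, N ω)) P)
    (hN_indep : iIndepFun (fun (ml : Fin M × Fin L) (ω : Ω) => N ω ml.1 ml.2) P)
    {v : ℝ≥0} (hv : v ≠ 0) (hN_law : ∀ m l, P.map (fun ω => N ω m l) = complexGaussian v)
    {E : ℝ} (hE0 : 0 ≤ E) (hE : ∀ᵐ ω ∂P, ∑ l, ‖x ω l‖ ^ 2 = E) :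
    condMutualInfo P (echoSignal g x N) g x ≠ ∞ ∧
      (condMutualInfo P (echoSignal g x N) g x).toReal =
        ∑ i, Real.log (1 + E / v * (corrMatrix_isHermitian P g).eigenvalues i) := by
  have hg2 := hgc.memLp hg
  obtain ⟨B, hB, hB', hBd⟩ := exists_unitary_corrMatrix_mulVec_eq_diagonal hg2
  set ev := (corrMatrix_isHermitian P g).eigenvalues
  have hev : ∀ i, 0 ≤ ev i := corrMatrix_eigenvalues_nonneg hg2
  have hv0 : (0 : ℝ) < v := by positivity
  have := Measure.isProbabilityMeasure_map (μ := P) hN.aemeasurable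
  have hY : Measurable (echoSignal g x N) := by
    unfold echoSignal
    fun_prop
  have hBm := measurable_mulVec B
  have hrk : ∀ (z : Fin L → ℂ) (y : Fin M → Fin L → ℂ),
      ∫⁻ w, ENNReal.ofReal (Real.exp (echoLogDensity v B (z, (y, w)))) ∂(P.map g) =
        ENNReal.ofReal (Real.exp (echoMarginalLogDensity v B ev (z, y))) := by
    intro z y
    have hm : Measurable fun w => echoLogDensity v B (z, (y, w)) :=
      (measurable_echoLogDensity (v : ℝ) B).comp (by fun_prop)
    rw [lintegral_map (by fun_prop) hg]
    exact (hgc.mulVec B).lintegral_exp_sq (by fun_prop) (d := fun i => ⟨ev i, hev i⟩) hBd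
      (c := (∑ l, ‖z l‖ ^ 2) / v) (by positivity) (fun i => B.mulVec (matchedFilter z y) i / v)
  have hdens := fun i => integral_scalar_information_density (P := P)
    (memLp_mulVec hg2 B i) (memLp_mulVec (memLp_matchedFilter hx hN hN_law hE) B i) hv0 (hev i) hE0
    (integral_norm_sq_of_corrMatrix_eq (by rw [hBd, Matrix.diagonal_apply_eq]))
    (integral_norm_sq_of_corrMatrix_eq (g := fun ω => B.mulVec (matchedFilter (x ω) (N ω))) (by
      rw [corrMatrix_mulVec (memLp_matchedFilter hx hN hN_law hE),
        corrMatrix_matchedFilter hx hN (hxgN.comp measurable_id measurable_snd) hN_indep hN_law hE,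
        Matrix.mul_smul, Matrix.mul_one, Matrix.smul_mul, hB']
      simp))
    (integral_conj_mul_matchedFilter hg hx hN hgN hxgN hN_law hE hg2 B i)
  -- The densities involve the random energy of `x`; replacing it by the constant `E`, almost
  -- surely, splits the information density into scalar channels.
  have hae : (fun ω => echoLogDensity v B (x ω, (echoSignal g x N ω, g ω)) -
      echoMarginalLogDensity v B ev (x ω, echoSignal g x N ω)) =ᵐ[P]
      fun ω => ∑ i, (-(E / v) * ‖B.mulVec (g ω) i‖ ^ 2 + 2 * (star (B.mulVec (g ω) i) *
        ((E * B.mulVec (g ω) i + B.mulVec (matchedFilter (x ω) (N ω)) i) / (v : ℝ))).re -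
        (ev i * ‖(E * B.mulVec (g ω) i + B.mulVec (matchedFilter (x ω) (N ω)) i) / (v : ℝ)‖ ^ 2 /
          (1 + E / v * ev i) - Real.log (1 + E / v * ev i))) := by
    filter_upwards [hE] with ω hω
    rw [Finset.sum_sub_distrib]
    simp only [echoLogDensity, echoMarginalLogDensity, echoSignal_matchedFilter, hω]
  obtain ⟨h1, h2⟩ := condMutualInfo_eq_integral P hY hg hx
    (hxgN.comp measurable_id measurable_fst) (P.map N) (measurable_echoLogDensity (v : ℝ) B)
    (measurable_echoMarginalLogDensity (v : ℝ) B ev)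
    (map_echoSignal_eq_withDensity hg hx hN hgN hxgN hN_indep hv hN_law hB) hrk
    ((integrable_finsetSum _ fun i _ => (hdens i).1).congr hae.symm)
  refine ⟨h1, h2.trans ?_⟩
  rw [integral_congr_ae hae, integral_finsetSum _ fun i _ => (hdens i).1]
  exact Finset.sum_congr rfl fun i _ => (hdens i).2

/-! ### Determinant formula and high-SNR asymptotics -/

theorem Matrix.IsHermitian.det_one_add_smul {n : ℕ} {A : Matrix (Fin n) (Fin n) ℂ}
    (hA : A.IsHermitian) (c : ℝ) :
    (1 + (c : ℂ) • A).det = ((∏ i, (1 + c * hA.eigenvalues i) : ℝ) : ℂ) := by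
  set U : Matrix (Fin n) (Fin n) ℂ := (hA.eigenvectorUnitary).1
  have hU : U * star U = 1 := Matrix.mem_unitaryGroup_iff.1 hA.eigenvectorUnitary.2
  have hdiag : A = U * Matrix.diagonal (fun i => (hA.eigenvalues i : ℂ)) * star U := by
    have := hA.spectral_theorem
    rw [Unitary.conjStarAlgAut_apply] at this
    exact this
  have h : 1 + (c : ℂ) • A =
      U * Matrix.diagonal (fun i => ((1 + c * hA.eigenvalues i : ℝ) : ℂ)) * star U := by
    have hd : Matrix.diagonal (fun i => ((1 + c * hA.eigenvalues i : ℝ) : ℂ)) =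
        1 + (c : ℂ) • Matrix.diagonal (fun i => (hA.eigenvalues i : ℂ)) := by
      rw [← Matrix.diagonal_one, ← Matrix.diagonal_smul, Matrix.diagonal_add]
      congr 1
      funext i
      simp
    rw [hd, mul_add, add_mul, mul_one, hU, Matrix.mul_smul, Matrix.smul_mul, ← hdiag]
  rw [h, Matrix.det_mul_right_comm, hU, one_mul, Matrix.det_diagonal]
  push_cast
  rfl

/-- For `p > 0` the difference equals `log₂ (1 + 1 / (p k))`. -/
theorem tendsto_logb_one_add_mul_sub {k : ℝ} (hk : 0 < k) :
    Tendsto (fun p : ℝ => Real.logb 2 (1 + p * k) - (Real.logb 2 p + Real.logb 2 k)) atTop (𝓝 0) := by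
  have h1 : Tendsto (fun p : ℝ => Real.logb 2 (1 + (p * k)⁻¹)) atTop (𝓝 0) := by
    have h2 : Tendsto (fun p : ℝ => 1 + (p * k)⁻¹) atTop (𝓝 1) := by
      have := (tendsto_inv_atTop_zero.comp (tendsto_id.atTop_mul_const hk)).const_add 1
      simpa using this
    have := (Real.continuousAt_log one_ne_zero).tendsto.comp h2
    have := this.div_const (Real.log 2)
    simpa [Real.logb] using this
  refine h1.congr' ?_
  filter_upwards [eventually_gt_atTop 0] with p hp
  have hpk : 0 < p * k := by positivity
  rw [← Real.logb_mul hp.ne' hk.ne', ← Real.logb_div (by positivity) hpk.ne']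
  congr 1
  field_simp
  ring

theorem corollary1 {Ω : Type*} [MeasurableSpace Ω] (P : Measure Ω) [IsProbabilityMeasure P]
    (M L K : ℕ) (hL : 0 < L)
    (κ μ σ : ℝ) (hκ0 : 0 ≤ κ) (hκ1 : κ < 1) (hμ0 : 0 ≤ μ) (hμ1 : μ ≤ 1) (hσ : 0 < σ)
    -- steering vector, angles of arrival and complex amplitudes of the targets
    (a : ℝ → Fin M → ℂ) (θ : Fin K → ℝ)
    (b : Ω → Fin K → ℂ) (hb_meas : Measurable b) (hb : IsCircularGaussian P b)
    -- white Gaussian noise on the radar sub-band: i.i.d. entries, of variance `(1 - κ) σ²`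
    (N : Ω → Fin M → Fin L → ℂ) (hN_meas : Measurable N)
    (hN_indep : iIndepFun (fun (ml : Fin M × Fin L) (ω : Ω) => N ω ml.1 ml.2) P)
    (hN_law : ∀ m l,
      P.map (fun ω => N ω m l) = complexGaussian (Real.toNNReal ((1 - κ) * σ ^ 2)))
    -- unit-power radar waveform
    (s : Ω → Fin L → ℂ) (hs_meas : Measurable s)
    (hs_power : ∀ᵐ ω ∂P, ∑ l, ‖s ω l‖ ^ 2 = (L : ℝ))
    -- waveform, target amplitudes and noise are mutually independent
    (hbN : IndepFun b N P) (hs : IndepFun s (fun ω => (b ω, N ω)) P) :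
    let g : Ω → Fin M → ℂ := targetResponse a θ b
    let R : Matrix (Fin M) (Fin M) ℂ := corrMatrix P g
    let ev : Fin M → ℝ := (corrMatrix_isHermitian P g).eigenvalues
    let A : ℝ → Matrix (Fin M) (Fin M) ℂ := fun p =>
      1 + (((1 - μ) * p * L / ((1 - κ) * σ ^ 2) : ℝ) : ℂ) • R
    -- exact expression; the mutual information is finite and the determinant a positive real
    (∀ p : ℝ, 0 ≤ p →
      sensingMI P μ g s N p ≠ ∞ ∧ 0 < (A p).det.re ∧ (A p).det.im = 0 ∧
      fdsacSensingRate P κ μ g s N p = (1 - κ) / L * Real.logb 2 (A p).det.re) ∧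
    -- the number of positive eigenvalues, with multiplicity, is the rank
    (Finset.univ.filter (fun i => 0 < ev i)).card = R.rank ∧
    -- high-SNR expansion and high-SNR slope
    (μ < 1 →
      Tendsto (fun p : ℝ => fdsacSensingRate P κ μ g s N p -
          ((R.rank : ℝ) * (1 - κ) / L * Real.logb 2 p +
            (1 - κ) / L * ∑ i ∈ Finset.univ.filter (fun i => 0 < ev i),
              Real.logb 2 ((1 - μ) * ev i * L / ((1 - κ) * σ ^ 2))))
        atTop (𝓝 0) ∧
      Tendsto (fun p : ℝ => fdsacSensingRate P κ μ g s N p / Real.logb 2 p)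
        atTop (𝓝 ((1 - κ) * (R.rank : ℝ) / L))) := by
  intro g R ev A
  -- As a linear image of the amplitudes, `g` inherits circular Gaussianity and the independence
  -- relations.
  have hgeq : g = fun ω => (Matrix.of fun m k => a (θ k) m).mulVec (b ω) := by
    funext ω m
    simp [g, targetResponse, Matrix.mulVec, dotProduct, mul_comm]
  have hgb : Measurable fun β : Fin K → ℂ => (Matrix.of fun m k => a (θ k) m).mulVec β := by
    unfold Matrix.mulVec dotProduct
    fun_prop
  have hgc : IsCircularGaussian P g := hgeq ▸ hb.mulVec _
  have hg : Measurable g := by rw [hgeq]; fun_prop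
  have hgN : IndepFun g N P := by
    rw [hgeq]
    exact hbN.comp hgb measurable_id
  have hev : ∀ i, 0 ≤ ev i := corrMatrix_eigenvalues_nonneg (hgc.memLp hg)
  have hvpos : 0 < (1 - κ) * σ ^ 2 := mul_pos (by linarith) (by positivity)
  have hv : Real.toNNReal ((1 - κ) * σ ^ 2) ≠ 0 := by simpa using hvpos
  have hMI : ∀ p : ℝ, 0 ≤ p → sensingMI P μ g s N p ≠ ∞ ∧ (sensingMI P μ g s N p).toReal =
      ∑ i, Real.log (1 + (1 - μ) * p * L / ((1 - κ) * σ ^ 2) * ev i) := by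
    intro p hp
    have hq : 0 ≤ (1 - μ) * p := mul_nonneg (by linarith) hp
    have hxm : Measurable fun y : Fin L → ℂ => fun l => (√((1 - μ) * p) : ℂ) * y l := by fun_prop
    have hE : ∀ᵐ ω ∂P, ∑ l, ‖radarWaveform μ p s ω l‖ ^ 2 = (1 - μ) * p * L := by
      filter_upwards [hs_power] with ω hω
      simp only [radarWaveform, norm_mul, mul_pow]
      rw [← Finset.mul_sum, hω, Complex.norm_real, Real.norm_eq_abs, sq_abs, Real.sq_sqrt hq]
    have hxgN : IndepFun (radarWaveform μ p s) (fun ω => (g ω, N ω)) P := by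
      rw [hgeq]
      exact hs.comp (ψ := fun w : (Fin K → ℂ) × (Fin M → Fin L → ℂ) =>
        ((Matrix.of fun m k => a (θ k) m).mulVec w.1, w.2)) hxm (by fun_prop)
    have h := condMutualInfo_echoSignal hg (hxm.comp hs_meas) hN_meas hgc hgN hxgN hN_indep hv
      hN_law (by positivity) hE
    rw [Real.coe_toNNReal _ hvpos.le] at h
    exact h
  have hfac : ∀ p : ℝ, 0 ≤ p → ∀ i, 0 < 1 + (1 - μ) * p * L / ((1 - κ) * σ ^ 2) * ev i := by
    intro p hp i
    have : 0 ≤ (1 - μ) * p * L / ((1 - κ) * σ ^ 2) :=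
      div_nonneg (mul_nonneg (mul_nonneg (by linarith) hp) (by positivity)) hvpos.le
    have := mul_nonneg this (hev i)
    linarith
  have hdet : ∀ p, (A p).det =
      ((∏ i, (1 + (1 - μ) * p * L / ((1 - κ) * σ ^ 2) * ev i) : ℝ) : ℂ) := fun p =>
    (corrMatrix_isHermitian P g).det_one_add_smul _
  have hrate : ∀ p : ℝ, 0 ≤ p → fdsacSensingRate P κ μ g s N p =
      (1 - κ) / L * ∑ i, Real.logb 2 (1 + (1 - μ) * p * L / ((1 - κ) * σ ^ 2) * ev i) := by
    intro p hp
    rw [fdsacSensingRate, (hMI p hp).2, Finset.sum_div]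
    rfl
  have hrank : (Finset.univ.filter (fun i => 0 < ev i)).card = R.rank := by
    rw [(corrMatrix_isHermitian P g).rank_eq_card_non_zero_eigs, Fintype.card_subtype]
    congr 1
    ext i
    simp only [Finset.mem_filter, Finset.mem_univ, true_and]
    exact ⟨fun h => h.ne', fun h => lt_of_le_of_ne (hev i) (Ne.symm h)⟩
  refine ⟨fun p hp => ⟨(hMI p hp).1, ?_, ?_, ?_⟩, hrank, fun hμ => ?_⟩
  · rw [hdet, Complex.ofReal_re]
    exact Finset.prod_pos fun i _ => hfac p hp i
  · rw [hdet, Complex.ofReal_im]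
  · rw [hrate p hp, hdet, Complex.ofReal_re, Real.logb_prod _ _ fun i _ => (hfac p hp i).ne']
  · have hL' : (0 : ℝ) < L := by exact_mod_cast hL
    have hexp : Tendsto (fun p : ℝ => fdsacSensingRate P κ μ g s N p -
          ((R.rank : ℝ) * (1 - κ) / L * Real.logb 2 p +
            (1 - κ) / L * ∑ i ∈ Finset.univ.filter (fun i => 0 < ev i),
              Real.logb 2 ((1 - μ) * ev i * L / ((1 - κ) * σ ^ 2)))) atTop (𝓝 0) := by
      have hsum := (tendsto_finsetSum (Finset.univ.filter (fun i => 0 < ev i)) fun i hi =>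
        tendsto_logb_one_add_mul_sub (k := (1 - μ) * ev i * L / ((1 - κ) * σ ^ 2)) (by
          have := (Finset.mem_filter.1 hi).2
          have := sub_pos.2 hμ
          positivity)).const_mul ((1 - κ) / L)
      rw [Finset.sum_const_zero, mul_zero] at hsum
      refine hsum.congr' ?_
      filter_upwards [eventually_ge_atTop 0] with p hp
      -- Zero eigenvalues contribute `log₂ 1 = 0`.
      have hpos : ∑ i, Real.logb 2 (1 + (1 - μ) * p * L / ((1 - κ) * σ ^ 2) * ev i) =
          ∑ i ∈ Finset.univ.filter (fun i => 0 < ev i),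
            Real.logb 2 (1 + p * ((1 - μ) * ev i * L / ((1 - κ) * σ ^ 2))) := by
        rw [Finset.sum_filter]
        refine Finset.sum_congr rfl fun i _ => ?_
        split_ifs with h
        · congr 2
          ring
        · rw [le_antisymm (not_lt.1 h) (hev i)]
          simp
      rw [hrate p hp, hpos, Finset.sum_sub_distrib, Finset.sum_add_distrib, Finset.sum_const,
        hrank, nsmul_eq_mul]
      ring
    refine ⟨hexp, ?_⟩
    have hlog : Tendsto (fun p : ℝ => Real.logb 2 p) atTop atTop :=
      Real.tendsto_logb_atTop (by norm_num)
    -- The rate minus its `log₂ p` term converges, so dividing it by `log₂ p` gives zero in the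
    -- limit.
    have hlim := (hexp.add_const ((1 - κ) / L * ∑ i ∈ Finset.univ.filter (fun i => 0 < ev i),
      Real.logb 2 ((1 - μ) * ev i * L / ((1 - κ) * σ ^ 2)))).div_atTop hlog
    have hlim' := hlim.const_add ((1 - κ) * (R.rank : ℝ) / L)
    rw [add_zero] at hlim'
    refine hlim'.congr' ?_
    filter_upwards [hlog.eventually_gt_atTop 0] with p hp
    field_simp
    ring
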